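/- A semiring is a non-empty set $S$ with two associative binary operations $+$ and $\cdot$ such that $+$ is commutative and $\cdot$ distributes over $+$ from both sides (neither a zero nor a unity is required). A subsemiring is a non-empty subset closed under both operations. A congruence on a semiring is an equivalence relation preserved under both operations, and a semiring is congruence-simple if it has exactly two congruences. Put $SS=\{ab : a,b\in S\}$. An element $w\in S$ is bi-absorbing if $aw=wa=w$ and $a+w=w$ for every $a\in S$. Let $\mathbf{M}_n(S)$ denote the semiring of all $n\times n$ matrices over $S$ with the usual addition and multiplication, let $L_2(\vee,\wedge)$ denote the two-element lattice $\{0<1\}$ with the join as addition and the meet as multiplication, and let $\mathbb{R}(\max,+)$ denote the semiring on the set $\mathbb{R}$ of real numbers with the maximum as addition and the usual sum as multiplication. **Theorem.** Let $S$ be a commutative semiring with $a+a=a$ for every $a\in S$, and let $n\geq 2$. Then the following conditions are equivalent: (i) $\mathbf{M}_n(S)$ is congruence-simple. (ii) $S$ is congruence-simple, $|SS|\neq 1$ and $S$ has no bi-absorbing element. (iii) $S$ is isomorphic either to $L_2(\vee,\wedge)$ or to a subsemiring $A$ of $\mathbb{R}(\max,+)$ that contains a (strictly) positive real number and a (strictly)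 negative real number. -/

import Mathlib

open scoped Pointwise

/-! Semirings here are non-empty sets with a commutative associative addition and an associative
multiplication that distributes over it on both sides. Neither a zero nor a unity is required, so
they are given by the classes `AddCommSemigroup`, `Semigroup` (or `CommSemigroup`),
`LeftDistribClass` and `RightDistribClass`. -/

/-- A semiring is congruence-simple if it has exactly two congruences. -/
def CongruenceSimple (R : Type*) [Add R] [Mul R] : Prop :=
  Nat.card (RingCon R) = 2

/-- `w` is bi-absorbing if it is multiplicatively absorbing (on both sides) and `a + w = w`
for every `a`. -/
def IsBiAbsorbing {R : Type*} [Add R] [Mul R] (w : R) : Prop :=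
  (∀ a : R, a * w = w) ∧ (∀ a : R, w * a = w) ∧ ∀ a : R, a + w = w

section Sum

/-- The sum of a non-empty finite family, computed in `S` with a new zero adjoined, is not the
adjoined zero. -/
theorem sum_coe_withZero_ne_zero {S : Type*} [AddCommSemigroup S] {ι : Type*} [Fintype ι]
    [Nonempty ι] (f : ι → S) : (∑ i, (f i : WithZero S)) ≠ 0 := by
  classical
  have key : ∀ s : Finset ι, s.Nonempty → ∃ a : S, (∑ i ∈ s, (f i : WithZero S)) = a := by
    intro s hs
    induction hs using Finset.Nonempty.cons_induction with
    | singleton i => exact ⟨f i, by simp⟩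
    | cons i s hi _ ih =>
      obtain ⟨a, ha⟩ := ih
      exact ⟨f i + a, by rw [Finset.sum_cons, ha, WithZero.coe_add]⟩
  obtain ⟨a, ha⟩ := key Finset.univ Finset.univ_nonempty
  rw [ha]
  exact WithZero.coe_ne_zero

/-- The sum of a non-empty finite family in a commutative additive semigroup. -/
noncomputable def nonemptySum {S : Type*} [AddCommSemigroup S] {ι : Type*} [Fintype ι]
    [Nonempty ι] (f : ι → S) : S :=
  WithZero.unzero (sum_coe_withZero_ne_zero f)

theorem coe_nonemptySum {S : Type*} [AddCommSemigroup S] {ι : Type*} [Fintype ι]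
    [Nonempty ι] (f : ι → S) : ((nonemptySum f : S) : WithZero S) = ∑ i, (f i : WithZero S) :=
  WithZero.coe_unzero _

theorem nonemptySum_fin_one {S : Type*} [AddCommSemigroup S] (f : Fin 1 → S) :
    nonemptySum f = f 0 := by
  apply WithZero.coe_injective
  rw [coe_nonemptySum, Fin.sum_univ_one]

theorem nonemptySum_fin_succ {S : Type*} [AddCommSemigroup S] {n : ℕ} [NeZero n]
    (f : Fin (n + 1) → S) :
    nonemptySum f = nonemptySum (fun i : Fin n => f i.castSucc) + f (Fin.last n) := by
  apply WithZero.coe_injective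
  rw [WithZero.coe_add, coe_nonemptySum, coe_nonemptySum, Fin.sum_univ_castSucc]

end Sum

/-- The `n × n` matrices over `S`. This is a type of its own because the product of Mathlib's
matrices needs a zero in `S`. -/
def MatrixSemiring (n : ℕ) (S : Type*) : Type _ := Fin n → Fin n → S

namespace MatrixSemiring

instance {n : ℕ} {S : Type*} [Add S] : Add (MatrixSemiring n S) :=
  ⟨fun A B i j => A i j + B i j⟩

noncomputable instance {n : ℕ} [NeZero n] {S : Type*} [AddCommSemigroup S] [Mul S] :
    Mul (MatrixSemiring n S) :=
  ⟨fun A B i j => nonemptySum fun k => A i k * B k j⟩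

end MatrixSemiring

/-- The two-element lattice `{0 < 1}` as a semiring: addition is the join, multiplication is the
meet. -/
def TwoLattice : Type := Bool

namespace TwoLattice

instance : Add TwoLattice := ⟨fun a b => max (α := Bool) a b⟩

instance : Mul TwoLattice := ⟨fun a b => min (α := Bool) a b⟩

end TwoLattice

/-- The max-plus semiring on the real numbers (without `-∞`): since the order is reversed, the
tropical addition is the maximum. -/
abbrev MaxPlus : Type := Tropical ℝᵒᵈ

namespace MaxPlus

/-- The real number underlying an element of the max-plus semiring. -/
def toReal (x : MaxPlus) : ℝ := OrderDual.ofDual (Tropical.untrop x)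

theorem toReal_add (x y : MaxPlus) : (x + y).toReal = max x.toReal y.toReal := rfl

theorem toReal_mul (x y : MaxPlus) : (x * y).toReal = x.toReal + y.toReal := rfl

end MaxPlus

/-- A subsemiring: a non-empty subset closed under addition and multiplication. -/
structure PlainSubsemiring (R : Type*) [Add R] [Mul R] extends
    AddSubsemigroup R, Subsemigroup R where
  nonempty' : carrier.Nonempty

namespace PlainSubsemiring

instance {R : Type*} [Add R] [Mul R] : SetLike (PlainSubsemiring R) R where
  coe A := A.carrier
  coe_injective A B h := by
    obtain ⟨⟨A, hA⟩, hA', hA''⟩ := A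
    obtain ⟨⟨B, hB⟩, hB', hB''⟩ := B
    congr

instance {R : Type*} [Add R] [Mul R] : AddMemClass (PlainSubsemiring R) R where
  add_mem {A} := A.add_mem'

instance {R : Type*} [Add R] [Mul R] : MulMemClass (PlainSubsemiring R) R where
  mul_mem {A} := A.mul_mem'

end PlainSubsemiring

/-! Every implication comes from writing down a congruence and using that it is trivial or full.
From matrices to `S`: congruences of `S` act entrywise. A one-element `SS` makes equality of a
single entry a congruence, and a bi-absorbing `w` makes the matrices with some entry `w` a
collapsible ideal. Classification: the kernel of `x ↦ a * x` is a congruence, so each multiplication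
is constant or injective. A constant one forces `L₂` (`CongruenceSimple.isCancelMul_or_twoLattice`).
Otherwise `S` is cancellative; simplicity makes its natural order Archimedean, hence total, and
Hölder's theorem for the group of fractions embeds `S` in `ℝ` (`CongruenceSimple.exists_maxPlus`).
Values of one sign only would leave a proper collapsible ideal. Back to matrices: multiplying by
suitable matrices isolates an entry where two related matrices differ, giving distinct related
constant matrices. Simplicity of `S` relates all constants, and these bound every matrix from both
sides (`CongruenceSimple.matrixSemiring`). -/

theorem congruenceSimple_iff {R : Type*} [Add R] [Mul R] :
    CongruenceSimple R ↔
      Nontrivial R ∧ ∀ (c : RingCon R) (a b : R), a ≠ b → c a b → ∀ x y, c x y := by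
  unfold CongruenceSimple
  constructor
  · intro h
    have hnt : Nontrivial R := by
      by_contra hR
      rw [not_nontrivial_iff_subsingleton] at hR
      have : Nat.card (RingCon R) = 1 := Nat.card_unique
      omega
    refine ⟨hnt, fun c a b hab hc x y => ?_⟩
    obtain ⟨d, -, hd⟩ := (Nat.card_eq_two_iff' (⊥ : RingCon R)).1 h
    have hc' : c ≠ ⊥ := by
      rintro rfl
      exact hab hc
    rw [hd c hc', ← hd ⊤ top_ne_bot]
    trivial
  · rintro ⟨hnt, h⟩
    refine (Nat.card_eq_two_iff' (⊥ : RingCon R)).2 ⟨⊤, top_ne_bot, fun c hc => ?_⟩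
    by_contra hc'
    apply hc
    ext a b
    refine ⟨fun hab => ?_, fun hab => ?_⟩
    · by_contra hne
      apply hc'
      ext x y
      exact ⟨fun _ => trivial, fun _ => h c a b hne hab x y⟩
    · obtain rfl : a = b := hab
      exact c.refl a

/-- In a congruence-simple semiring, a multiplicative ideal with at least two elements that is
collapsed compatibly with addition is the whole semiring. -/
theorem CongruenceSimple.mem_of_ideal {R : Type*} [AddCommSemigroup R] [Mul R]
    (hR : CongruenceSimple R) {I : Set R} (hmul : ∀ x ∈ I, ∀ z, x * z ∈ I)
    (hmul' : ∀ x ∈ I, ∀ z, z * x ∈ I)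
    (hadd : ∀ x ∈ I, ∀ y ∈ I, ∀ z, x + z = y + z ∨ x + z ∈ I ∧ y + z ∈ I)
    (hI : I.Nontrivial) (x : R) : x ∈ I := by
  have htrans : ∀ {x y z : R}, (x = y ∨ x ∈ I ∧ y ∈ I) → (y = z ∨ y ∈ I ∧ z ∈ I) →
      (x = z ∨ x ∈ I ∧ z ∈ I) := by
    rintro x y z (rfl | h) (rfl | h')
    · exact Or.inl rfl
    · exact Or.inr h'
    · exact Or.inr h
    · exact Or.inr ⟨h.1, h'.2⟩
  have hadd' : ∀ {x y : R} (z : R), (x = y ∨ x ∈ I ∧ y ∈ I) →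
      (x + z = y + z ∨ x + z ∈ I ∧ y + z ∈ I) := by
    rintro x y z (rfl | h)
    · exact Or.inl rfl
    · exact hadd x h.1 y h.2 z
  let c : RingCon R :=
    { r := fun x y => x = y ∨ x ∈ I ∧ y ∈ I
      iseqv := ⟨fun _ => Or.inl rfl, fun h => h.imp Eq.symm And.symm, htrans⟩
      add' := fun {x y z w} h h' => htrans (hadd' z h) (by
        rw [add_comm y z, add_comm y w]
        exact hadd' y h')
      mul' := by
        rintro x y z w (rfl | h) (rfl | h')
        · exact Or.inl rfl
        · exact Or.inr ⟨hmul' _ h'.1 _, hmul' _ h'.2 _⟩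
        · exact Or.inr ⟨hmul _ h.1 _, hmul _ h.2 _⟩
        · exact Or.inr ⟨hmul _ h.1 _, hmul _ h.2 _⟩ }
  obtain ⟨a, ha, b, hb, hab⟩ := hI
  rcases (congruenceSimple_iff.1 hR).2 c a b hab (Or.inr ⟨ha, hb⟩) x a with rfl | h
  · exact ha
  · exact h.1

/-! ### Non-empty sums under idempotent addition -/

section NonemptySum

variable {S : Type*} [AddCommSemigroup S] {ι : Type*} [Fintype ι] [Nonempty ι]

theorem nonemptySum_induction₂ {f g : ι → S} (r : S → S → Prop)
    (hadd : ∀ a b c d, r a b → r c d → r (a + c) (b + d)) (h : ∀ i, r (f i) (g i)) :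
    r (nonemptySum f) (nonemptySum g) := by
  classical
  have key : ∀ s : Finset ι, s.Nonempty → ∃ a b : S, (∑ i ∈ s, (f i : WithZero S)) = a ∧
      (∑ i ∈ s, (g i : WithZero S)) = b ∧ r a b := by
    intro s hs
    induction hs using Finset.Nonempty.cons_induction with
    | singleton i => exact ⟨f i, g i, by simp, by simp, h i⟩
    | cons i s hi _ ih =>
      obtain ⟨a, b, ha, hb, hab⟩ := ih
      exact ⟨f i + a, g i + b, by rw [Finset.sum_cons, ha, WithZero.coe_add],
        by rw [Finset.sum_cons, hb, WithZero.coe_add], hadd _ _ _ _ (h i) hab⟩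
  obtain ⟨a, b, ha, hb, hab⟩ := key Finset.univ Finset.univ_nonempty
  rw [← coe_nonemptySum] at ha hb
  rwa [WithZero.coe_injective ha, WithZero.coe_injective hb]

theorem nonemptySum_induction {f : ι → S} (p : S → Prop)
    (hadd : ∀ a b, p a → p b → p (a + b)) (h : ∀ i, p (f i)) : p (nonemptySum f) :=
  nonemptySum_induction₂ (g := f) (fun a _ => p a) (fun _ _ _ _ ha hc => hadd _ _ ha hc) h

theorem add_nonemptySum (hidem : ∀ a : S, a + a = a) (f : ι → S) (i : ι) :
    f i + nonemptySum f = nonemptySum f := by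
  classical
  apply WithZero.coe_injective
  rw [WithZero.coe_add, coe_nonemptySum, ← Finset.add_sum_erase _ _ (Finset.mem_univ i),
    ← add_assoc, ← WithZero.coe_add, hidem]

/-- A dominating summand absorbs the others; this evaluates entries of matrix products. -/
theorem nonemptySum_eq_of_add_eq (hidem : ∀ a : S, a + a = a) {f : ι → S} {i : ι}
    (h : ∀ j, f j + f i = f i) : nonemptySum f = f i := by
  have h' : nonemptySum f + f i = f i :=
    nonemptySum_induction (fun x => x + f i = f i)
      (fun a b ha hb => by rw [add_assoc, hb, ha]) h
  rw [← h', add_comm, add_nonemptySum hidem]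

theorem nonemptySum_const (hidem : ∀ a : S, a + a = a) (a : S) :
    nonemptySum (fun _ : ι => a) = a :=
  nonemptySum_eq_of_add_eq hidem (i := Classical.arbitrary ι) fun _ => hidem a

end NonemptySum

/-! ### Matrices and entrywise congruences -/

namespace MatrixSemiring

instance {n : ℕ} {S : Type*} [AddCommSemigroup S] : AddCommSemigroup (MatrixSemiring n S) where
  add_assoc A B C := funext fun i => funext fun j => add_assoc (A i j) (B i j) (C i j)
  add_comm A B := funext fun i => funext fun j => add_comm (A i j) (B i j)

theorem entry_add {n : ℕ} {S : Type*} [Add S] (A B : MatrixSemiring n S) (i j : Fin n) :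
    (A + B) i j = A i j + B i j := rfl

theorem entry_mul {n : ℕ} [NeZero n] {S : Type*} [AddCommSemigroup S] [Mul S]
    (A B : MatrixSemiring n S) (i j : Fin n) :
    (A * B) i j = nonemptySum fun k => A i k * B k j := rfl

/-- The matrix all of whose entries are equal to `a`. -/
def const (n : ℕ) {S : Type*} (a : S) : MatrixSemiring n S := fun _ _ => a

theorem entry_const {n : ℕ} {S : Type*} (a : S) (i j : Fin n) : const n a i j = a := rfl

@[ext]
theorem ext {n : ℕ} {S : Type*} {A B : MatrixSemiring n S} (h : ∀ i j, A i j = B i j) : A = B :=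
  funext fun i => funext fun j => h i j

end MatrixSemiring

/-- The congruence of the matrix semiring that holds entrywise. -/
def RingCon.matrixSemiring {S : Type*} [AddCommSemigroup S] [Mul S] (c : RingCon S) (n : ℕ)
    [NeZero n] : RingCon (MatrixSemiring n S) where
  r A B := ∀ i j, c (A i j) (B i j)
  iseqv := ⟨fun _ _ _ => c.refl _, fun h i j => c.symm (h i j),
    fun h h' i j => c.trans (h i j) (h' i j)⟩
  add' h h' i j := c.add (h i j) (h' i j)
  mul' h h' i j := nonemptySum_induction₂ (c · ·) (fun _ _ _ _ h₁ h₂ => c.add h₁ h₂)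
    fun k => c.mul (h i k) (h' k j)

/-! ### Necessary conditions on the entries -/

section OfMatrix

open MatrixSemiring

variable {S : Type*} [AddCommSemigroup S] [CommSemigroup S] {n : ℕ} [NeZero n]

theorem CongruenceSimple.of_matrixSemiring (h : CongruenceSimple (MatrixSemiring n S)) :
    CongruenceSimple S := by
  rw [congruenceSimple_iff] at h ⊢
  obtain ⟨hnt, h⟩ := h
  constructor
  · by_contra hS
    rw [not_nontrivial_iff_subsingleton] at hS
    obtain ⟨A, B, hAB⟩ := hnt
    exact hAB (MatrixSemiring.ext fun i j => Subsingleton.elim _ _)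
  · intro c a b hab hc x y
    refine h (c.matrixSemiring n) (const n a) (const n b) (fun he => hab ?_)
      (fun _ _ => hc) (const n x) (const n y) 0 0
    exact congrFun (congrFun he 0) 0

theorem encard_mul_ne_one_of_matrixSemiring (h : CongruenceSimple (MatrixSemiring n S))
    (hn : 2 ≤ n) : (Set.univ * Set.univ : Set S).encard ≠ 1 := by
  intro h1
  obtain ⟨w, hw⟩ := Set.encard_eq_one.1 h1
  have hmul : ∀ a b : S, a * b = w := fun a b => by
    have : a * b ∈ (Set.univ * Set.univ : Set S) := Set.mul_mem_mul trivial trivial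
    rwa [hw] at this
  obtain ⟨⟨a, b, hab⟩, -⟩ := congruenceSimple_iff.1 h.of_matrixSemiring
  have h10 : (⟨1, hn⟩ : Fin n) ≠ 0 := by
    intro h
    have := congrArg Fin.val h
    simp at this
  -- All matrix products coincide, so compatibility with multiplication is automatic.
  let c : RingCon (MatrixSemiring n S) :=
    { r := fun A B => A 0 0 = B 0 0
      iseqv := ⟨fun _ => rfl, fun h => h.symm, fun h h' => h.trans h'⟩
      add' := fun {A B C D} (h : A 0 0 = B 0 0) (h' : C 0 0 = D 0 0) => by
        change A 0 0 + C 0 0 = B 0 0 + D 0 0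
        rw [h, h']
      mul' := fun {A B C D} _ _ => by
        simp only [entry_mul, hmul] }
  have hfull := (congruenceSimple_iff.1 h).2 c (const n a) (fun i _ => if i = 0 then a else b)
    (fun he => by
      have := congrFun (congrFun he ⟨1, hn⟩) 0
      simp only [entry_const, h10, if_false] at this
      exact hab this)
    (by change a = if (0 : Fin n) = 0 then a else b; simp) (const n a) (const n b)
  exact hab hfull

theorem not_isBiAbsorbing_of_matrixSemiring (h : CongruenceSimple (MatrixSemiring n S))
    (hn : 2 ≤ n) (w : S) : ¬ IsBiAbsorbing w := by
  rintro ⟨hl, hr, ha⟩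
  have ha' : ∀ a : S, w + a = w := fun a => by rw [add_comm, ha]
  obtain ⟨hnt, -⟩ := congruenceSimple_iff.1 h.of_matrixSemiring
  obtain ⟨s, hs⟩ := exists_ne w
  have h10 : (⟨1, hn⟩ : Fin n) ≠ 0 := by
    intro h
    have := congrArg Fin.val h
    simp at this
  have hsum : ∀ (f : Fin n → S) (i : Fin n), f i = w → nonemptySum f = w := by
    classical
    intro f i hi
    apply WithZero.coe_injective
    rw [coe_nonemptySum, ← Finset.add_sum_erase _ _ (Finset.mem_univ i), hi]
    generalize (∑ j ∈ Finset.univ.erase i, (f j : WithZero S)) = t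
    rcases eq_or_ne t 0 with rfl | ht
    · rw [add_zero]
    · obtain ⟨t, rfl⟩ := WithZero.ne_zero_iff_exists.1 ht
      rw [← WithZero.coe_add, ha']
  have hfull := h.mem_of_ideal (I := {A | ∃ i j, A i j = w})
    (by
      rintro A ⟨i, j, hij⟩ B
      exact ⟨i, 0, hsum _ j (by rw [hij, hr])⟩)
    (by
      rintro A ⟨i, j, hij⟩ B
      exact ⟨0, j, hsum _ i (by rw [hij, hl])⟩)
    (by
      rintro A ⟨i, j, hij⟩ B ⟨k, l, hkl⟩ C
      exact Or.inr ⟨⟨i, j, by rw [entry_add, hij, ha']⟩, ⟨k, l, by rw [entry_add, hkl, ha']⟩⟩)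
    ⟨const n w, ⟨0, 0, rfl⟩, fun i _ => if i = 0 then w else s, ⟨0, 0, if_pos rfl⟩, fun he => by
      have := congrFun (congrFun he ⟨1, hn⟩) 0
      simp only [entry_const, h10, if_false] at this
      exact hs this.symm⟩ (const n s)
  obtain ⟨i, j, hij⟩ := hfull
  exact hs hij

end OfMatrix

/-! ### Simplicity of the matrix semiring -/

section ToMatrix

open MatrixSemiring

variable {S : Type*} [AddCommSemigroup S] [CommSemigroup S] [LeftDistribClass S]
  {n : ℕ} [NeZero n]

/-- Matrices over a congruence-simple idempotent commutative semiring form a congruence-simple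
semiring as soon as there are enough lower bounds for the natural order and some cancellable `c`
dominates arbitrarily many multiples. -/
theorem CongruenceSimple.matrixSemiring (hidem : ∀ a : S, a + a = a) (hS : CongruenceSimple S)
    (hlow : ∀ x y : S, ∃ t, t + x = x ∧ t + y = y) (c : S) (hc : ∀ x y, c * x = c * y → x = y)
    (hN : ∀ M m : S, ∃ N, N * M + c * m = c * m) :
    CongruenceSimple (MatrixSemiring n S) := by
  rw [congruenceSimple_iff] at hS ⊢
  obtain ⟨⟨a₀, b₀, hab₀⟩, hS⟩ := hS
  refine ⟨⟨const n a₀, const n b₀, fun h => hab₀ (congrFun (congrFun h 0) 0)⟩, ?_⟩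
  have hlower : ∀ A : MatrixSemiring n S, ∃ t, ∀ i j, t + A i j = A i j := by
    intro A
    have : IsTrans S (fun a b => b + a = a) :=
      ⟨fun a b c hab hbc => by rw [← hab, ← add_assoc, hbc]⟩
    have hdir : Directed (fun a b : S => b + a = a) id := fun x y => hlow x y
    have : Nonempty S := ⟨a₀⟩
    obtain ⟨t, ht⟩ := hdir.finite_le (fun p : Fin n × Fin n => A p.1 p.2)
    exact ⟨t, fun i j => ht (i, j)⟩
  have hupper : ∀ A : MatrixSemiring n S, ∃ t, ∀ i j, A i j + t = t := fun A =>
    ⟨nonemptySum fun p : Fin n × Fin n => A p.1 p.2, fun i j =>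
      add_nonemptySum hidem (fun p : Fin n × Fin n => A p.1 p.2) (i, j)⟩
  have hdom : ∀ A B : MatrixSemiring n S, ∃ N, ∀ i j k l,
      N * A i j + c * A k l = c * A k l ∧ N * B i j + c * B k l = c * B k l := by
    intro A B
    -- One `N` suffices for all entries: it is chosen for a common upper bound `t` and a common
    -- lower bound `s`.
    obtain ⟨t, ht⟩ := hupper (A + B)
    obtain ⟨a, ha⟩ := hlower A
    obtain ⟨b, hb⟩ := hlower B
    obtain ⟨s, hsa, hsb⟩ := hlow a b
    obtain ⟨N, h⟩ := hN t s
    have key : ∀ x y, x + t = t → s + y = y → N * x + c * y = c * y := by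
      intro x y hx hy
      calc N * x + c * y = N * x + (c * s + c * y) := by rw [← mul_add, hy]
        _ = N * x + (N * t + c * s + c * y) := by rw [h]
        _ = N * (x + t) + c * s + c * y := by rw [mul_add]; simp only [add_assoc]
        _ = c * y := by rw [hx, h, ← mul_add, hy]
    refine ⟨N, fun i j k l => ⟨key _ _ ?_ ?_, key _ _ ?_ ?_⟩⟩
    · rw [← ht i j, entry_add, ← add_assoc, ← add_assoc, hidem]
    · rw [← ha k l, ← add_assoc, hsa]
    · rw [← ht i j, entry_add, ← add_assoc, add_left_comm, add_comm (B i j), add_assoc, hidem, add_assoc]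
    · rw [← hb k l, ← add_assoc, hsb]
  intro r X Y hXY hr
  obtain ⟨i, j, hij⟩ : ∃ i j, X i j ≠ Y i j := by
    by_contra! h
    exact hXY (MatrixSemiring.ext h)
  have hrow : ∃ X' Y' : MatrixSemiring n S, r X' Y' ∧ (∀ k l, X' k l = c * X i l) ∧
      ∀ k l, Y' k l = c * Y i l := by
    obtain ⟨N, hN⟩ := hdom X Y
    -- In `P * Z` the term `c * Z i l` dominates all terms with factor `N`, so every row becomes `c`
    -- times row `i`. Below, `Q` does the same to columns.
    let P : MatrixSemiring n S := fun _ l => if l = i then c else N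
    have hP : ∀ (Z : MatrixSemiring n S) (_ : ∀ i j k l, N * Z i j + c * Z k l = c * Z k l) k l,
        (P * Z) k l = c * Z i l := by
      intro Z hZ k l
      have := nonemptySum_eq_of_add_eq hidem (f := fun m => P k m * Z m l) (i := i) (fun m => by
        by_cases hm : m = i
        · subst hm; exact hidem _
        · simpa [P, hm] using hZ m l i l)
      rw [entry_mul, this]
      simp [P]
    exact ⟨P * X, P * Y, r.mul (r.refl P) hr, hP X fun i j k l => (hN i j k l).1,
      hP Y fun i j k l => (hN i j k l).2⟩
  obtain ⟨X', Y', hr', hX', hY'⟩ := hrow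
  have hcol : r (const n (c * (c * X i j))) (const n (c * (c * Y i j))) := by
    obtain ⟨N, hN⟩ := hdom X' Y'
    let Q : MatrixSemiring n S := fun l _ => if l = j then c else N
    have hQ : ∀ (Z : MatrixSemiring n S) (_ : ∀ i j k l, N * Z i j + c * Z k l = c * Z k l) k l,
        (Z * Q) k l = c * Z k j := by
      intro Z hZ k l
      have := nonemptySum_eq_of_add_eq hidem (f := fun m => Z k m * Q m l) (i := j) (fun m => by
        by_cases hm : m = j
        · subst hm; exact hidem _
        · simpa [Q, hm, mul_comm] using hZ k m k j)
      rw [entry_mul, this]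
      simp [Q, mul_comm]
    have h := r.mul hr' (r.refl Q)
    have hX : X' * Q = const n (c * (c * X i j)) := MatrixSemiring.ext fun k l => by
      rw [hQ X' (fun i j k l => (hN i j k l).1), hX', entry_const]
    have hY : Y' * Q = const n (c * (c * Y i j)) := MatrixSemiring.ext fun k l => by
      rw [hQ Y' (fun i j k l => (hN i j k l).2), hY', entry_const]
    rwa [hX, hY] at h
  let d : RingCon S :=
    { r := fun a b => r (const n a) (const n b)
      iseqv := ⟨fun _ => r.refl _, fun h => r.symm h, fun h h' => r.trans h h'⟩
      add' := fun {_ _ _ _} h h' => r.add h h'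
      mul' := fun {a b a' b'} h h' => by
        have hconst : ∀ x y : S, const n x * const n y = const n (x * y) := fun x y =>
          MatrixSemiring.ext fun _ _ => nonemptySum_const hidem (x * y)
        have := r.mul h h'
        rwa [hconst, hconst] at this }
  have hconst : ∀ x y, r (const n x) (const n y) :=
    hS d _ _ (fun h => hij (hc _ _ (hc _ _ h))) hcol
  -- With `s` below and `t` above all entries, `A = A + const n s` is related to `A + const n t =
  -- const n t`.
  have hall : ∀ A : MatrixSemiring n S, r A (const n a₀) := by
    intro A
    obtain ⟨s, hs⟩ := hlower A
    obtain ⟨t, ht⟩ := hupper A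
    have h := r.add (r.refl A) (hconst s t)
    have h₁ : A + const n s = A := MatrixSemiring.ext fun i j => by
      rw [entry_add, entry_const, add_comm, hs]
    have h₂ : A + const n t = const n t := MatrixSemiring.ext fun i j => by
      rw [entry_add, entry_const, ht]
    rw [h₁, h₂] at h
    exact r.trans h (hconst t a₀)
  exact fun A B => r.trans (hall A) (r.symm (hall B))

end ToMatrix

/-! ### Subsemirings of max-plus with both signs -/

section MaxPlusEmbedding

variable {S : Type*} [CommSemigroup S] {φ : S → ℝ}

/-- The values of a max-plus valued homomorphism that takes a positive and a negative value meet
all sufficiently long intervals. -/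
theorem exists_mem_Icc_of_pos_of_neg (hmul : ∀ x y, φ (x * y) = φ x + φ y) {p q : S}
    (hp : 0 < φ p) (hq : φ q < 0) {u v : ℝ} (huv : u + φ p ≤ v) : ∃ x, u ≤ φ x ∧ φ x ≤ v := by
  have hdown : ∀ k : ℕ, ∃ x, φ x = (k + 1) * φ q := by
    intro k
    induction k with
    | zero => exact ⟨q, by simp⟩
    | succ k ih =>
      obtain ⟨x, hx⟩ := ih
      exact ⟨x * q, by rw [hmul, hx]; push_cast; ring⟩
  obtain ⟨k, hk⟩ := exists_nat_gt (v / φ q)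
  obtain ⟨y, hy⟩ := hdown k
  have hyv : φ y ≤ v := by
    rw [div_lt_iff_of_neg hq] at hk
    rw [hy]
    linarith
  have hup : ∀ m : ℕ, ∃ x, φ x = φ y + m * φ p := by
    intro m
    induction m with
    | zero => exact ⟨y, by simp⟩
    | succ m ih =>
      obtain ⟨x, hx⟩ := ih
      exact ⟨x * p, by rw [hmul, hx]; push_cast; ring⟩
  by_cases huy : u ≤ φ y
  · exact ⟨y, huy, hyv⟩
  · push Not at huy
    -- Climbing from `φ y` in steps of `φ p`, the first value to reach `u` overshoots by less than
    -- one step.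
    obtain ⟨x, hx⟩ := hup ⌈(u - φ y) / φ p⌉₊
    have h₁ := Nat.le_ceil ((u - φ y) / φ p)
    have h₂ := Nat.ceil_lt_add_one (div_nonneg (sub_nonneg.2 huy.le) hp.le)
    rw [div_le_iff₀ hp] at h₁
    have h₃ := mul_lt_mul_of_pos_right h₂ hp
    rw [add_mul, div_mul_cancel₀ _ hp.ne'] at h₃
    exact ⟨x, by linarith, by linarith⟩

variable [AddCommSemigroup S]

/-- Congruence classes are convex. Powers of a related pair `a`, `b` are related and arbitrarily far
apart, and a translate of such a pair encloses any given `x` and `y`. -/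
theorem congruenceSimple_of_maxPlus (hinj : Function.Injective φ)
    (hadd : ∀ x y, φ (x + y) = max (φ x) (φ y)) (hmul : ∀ x y, φ (x * y) = φ x + φ y) {p q : S}
    (hp : 0 < φ p) (hq : φ q < 0) : CongruenceSimple S := by
  rw [congruenceSimple_iff]
  refine ⟨⟨p, q, fun h => by rw [h] at hp; linarith⟩, ?_⟩
  have hconvex : ∀ (r : RingCon S) x y w, r x y → φ x ≤ φ w → φ w ≤ φ y → r w y := by
    intro r x y w hxy hxw hwy
    have h := r.add (r.refl w) hxy
    have h₁ : w + x = w := hinj (by rw [hadd, max_eq_left hxw])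
    have h₂ : w + y = y := hinj (by rw [hadd, max_eq_right hwy])
    rwa [h₁, h₂] at h
  suffices H : ∀ (r : RingCon S) a b, φ a < φ b → r a b → ∀ x y, φ x ≤ φ y → r x y by
    intro r a b hab hr x y
    have H' : ∀ x y, φ x ≤ φ y → r x y := by
      rcases lt_or_gt_of_ne (fun h => hab (hinj h)) with h | h
      · exact H r a b h hr
      · exact H r b a h (r.symm hr)
    rcases le_total (φ x) (φ y) with h | h
    · exact H' x y h
    · exact r.symm (H' y x h)
  intro r a b hab hr x y hxy
  have hpow : ∀ k : ℕ, ∃ c d, r c d ∧ φ c = (k + 1) * φ a ∧ φ d = (k + 1) * φ b := by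
    intro k
    induction k with
    | zero => exact ⟨a, b, hr, by simp, by simp⟩
    | succ k ih =>
      obtain ⟨c, d, h, hc, hd⟩ := ih
      exact ⟨c * a, d * b, r.mul h hr, by rw [hmul, hc]; push_cast; ring,
        by rw [hmul, hd]; push_cast; ring⟩
  -- The extra `φ p` makes the interval of admissible translations `z` long enough to contain a
  -- value of `φ`.
  obtain ⟨k, hk⟩ := exists_nat_gt ((φ y - φ x + φ p) / (φ b - φ a))
  rw [div_lt_iff₀ (sub_pos.2 hab)] at hk
  obtain ⟨c, d, hcd, hc, hd⟩ := hpow k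
  obtain ⟨z, hz, hz'⟩ := exists_mem_Icc_of_pos_of_neg hmul hp hq
    (u := φ y - φ d) (v := φ x - φ c) (by rw [hc, hd]; nlinarith)
  have h := r.mul hcd (r.refl z)
  have hx := hconvex r _ _ x h (by rw [hmul]; linarith) (by rw [hmul]; linarith)
  have hy := hconvex r _ _ y h (by rw [hmul]; linarith) (by rw [hmul]; linarith)
  exact r.trans hx (r.symm hy)

theorem congruenceSimple_matrixSemiring_of_maxPlus [LeftDistribClass S]
    (hinj : Function.Injective φ) (hadd : ∀ x y, φ (x + y) = max (φ x) (φ y))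
    (hmul : ∀ x y, φ (x * y) = φ x + φ y) {p q : S}
    (hp : 0 < φ p) (hq : φ q < 0) (n : ℕ) [NeZero n] :
    CongruenceSimple (MatrixSemiring n S) := by
  refine CongruenceSimple.matrixSemiring (fun a => hinj (by rw [hadd, max_self]))
    (congruenceSimple_of_maxPlus hinj hadd hmul hp hq) (fun x y => ?_) p (fun x y h => ?_)
    (fun M m => ?_)
  · rcases le_total (φ x) (φ y) with h | h
    · exact ⟨x, hinj (by rw [hadd, max_self]), hinj (by rw [hadd, max_eq_right h])⟩
    · exact ⟨y, hinj (by rw [hadd, max_eq_right h]), hinj (by rw [hadd, max_self])⟩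
  · have := congrArg φ h
    rw [hmul, hmul] at this
    exact hinj (add_left_cancel this)
  · obtain ⟨N, -, hN⟩ := exists_mem_Icc_of_pos_of_neg hmul hp hq
      (u := φ m - φ M) (v := φ p + φ m - φ M) (by linarith)
    exact ⟨N, hinj (by rw [hadd, hmul, hmul, max_eq_right (by linarith)])⟩

end MaxPlusEmbedding

/-! ### The two-element lattice -/

section TwoElements

variable {S : Type*} [AddCommSemigroup S] [CommSemigroup S]

theorem congruenceSimple_of_twoElements {z o : S} (hzo : z ≠ o) (hS : ∀ x, x = z ∨ x = o) :
    CongruenceSimple S := by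
  rw [congruenceSimple_iff]
  refine ⟨⟨z, o, hzo⟩, fun c a b hab hc => ?_⟩
  have h : c z o := by
    rcases hS a with rfl | rfl <;> rcases hS b with rfl | rfl
    · exact absurd rfl hab
    · exact hc
    · exact c.symm hc
    · exact absurd rfl hab
  intro x y
  rcases hS x with rfl | rfl <;> rcases hS y with rfl | rfl
  · exact c.refl _
  · exact h
  · exact c.symm h
  · exact c.refl _

theorem congruenceSimple_matrixSemiring_of_twoLattice [LeftDistribClass S]
    (hidem : ∀ a : S, a + a = a) (e : S ≃+* TwoLattice) (n : ℕ) [NeZero n] :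
    CongruenceSimple (MatrixSemiring n S) := by
  obtain ⟨z, o, hzo, hS, hadd, hmul, hone⟩ : ∃ z o : S, z ≠ o ∧ (∀ x, x = z ∨ x = o) ∧
      (∀ x, z + x = x) ∧ (∀ x, z * x = z) ∧ ∀ x, o * x = x := by
    obtain ⟨z, o, hzo, hS, hadd, hmul, hone⟩ : ∃ z o : TwoLattice, z ≠ o ∧ (∀ x, x = z ∨ x = o) ∧
        (∀ x, z + x = x) ∧ (∀ x, z * x = z) ∧ ∀ x, o * x = x :=
      ⟨(false : Bool), (true : Bool), Bool.false_ne_true, Bool.dichotomy, Bool.false_or,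
        Bool.false_and, Bool.true_and⟩
    refine ⟨e.symm z, e.symm o, e.symm.injective.ne hzo, fun x => ?_, fun x => ?_, fun x => ?_,
      fun x => ?_⟩ <;> obtain ⟨y, rfl⟩ := e.symm.surjective x
    · exact (hS y).imp (congrArg _) (congrArg _)
    · rw [← map_add, hadd]
    · rw [← map_mul, hmul]
    · rw [← map_mul, hone]
  refine CongruenceSimple.matrixSemiring hidem (congruenceSimple_of_twoElements hzo hS)
    (fun x y => ⟨z, hadd x, hadd y⟩) o (fun x y h => ?_) (fun M m => ⟨z, ?_⟩)
  · rwa [hone, hone] at h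
  · rw [hmul, hadd]

theorem nonempty_ringEquiv_twoLattice {o e : S} (hoe : o ≠ e) (hS : ∀ x, x = o ∨ x = e)
    (hee : e + e = e) (hadd : ∀ x, x + o = x) (hmul : ∀ x, o * x = o) (hmul' : e * e = e) :
    Nonempty (S ≃+* TwoLattice) := by
  classical
  have hadd' : ∀ x, o + x = x := fun x => by rw [add_comm, hadd]
  have hmul'' : ∀ x, x * o = o := fun x => by rw [mul_comm, hmul]
  obtain ⟨z, i, hzi, hL, hz, hz', hi, hzm, hzm', him⟩ : ∃ z i : TwoLattice, z ≠ i ∧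
      (∀ x, x = z ∨ x = i) ∧ (∀ x, z + x = x) ∧ (∀ x, x + z = x) ∧ i + i = i ∧
      (∀ x, z * x = z) ∧ (∀ x, x * z = z) ∧ i * i = i :=
    ⟨(false : Bool), (true : Bool), Bool.false_ne_true, Bool.dichotomy, Bool.false_or,
      Bool.or_false, rfl, Bool.false_and, Bool.and_false, rfl⟩
  let f : S → TwoLattice := fun x => if x = o then z else i
  have hfo : f o = z := if_pos rfl
  have hfe : f e = i := if_neg hoe.symm
  have hf : Function.Bijective f := by
    constructor
    · intro x y h
      rcases hS x with rfl | rfl <;> rcases hS y with rfl | rfl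
      · rfl
      · rw [hfo, hfe] at h
        exact absurd h hzi
      · rw [hfo, hfe] at h
        exact absurd h.symm hzi
      · rfl
    · intro b
      rcases hL b with rfl | rfl
      · exact ⟨o, hfo⟩
      · exact ⟨e, hfe⟩
  refine ⟨{ Equiv.ofBijective f hf with map_mul' := fun x y => ?_, map_add' := fun x y => ?_ }⟩
  · change f (x * y) = f x * f y
    rcases hS x with rfl | rfl
    · rw [hmul, hfo, hzm]
    · rcases hS y with rfl | rfl
      · rw [hmul'', hfo, hzm']
      · rw [hmul', hfe, him]
  · change f (x + y) = f x + f y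
    rcases hS x with rfl | rfl
    · rw [hadd', hfo, hz]
    · rcases hS y with rfl | rfl
      · rw [hadd, hfo, hz']
      · rw [hee, hfe, hi]

end TwoElements

/-! ### Hölder embedding of a cancellative ordered semigroup -/

section RealEmbedding

/-- A unit is adjoined before passing to fractions; multiplying numerator and denominator by an
element of `S` removes it again. -/
theorem exists_injective_mulHom_commGroup.{u} {S : Type u} [CommSemigroup S] [IsCancelMul S]
    [Nonempty S] :
    ∃ (G : Type u) (_ : CommGroup G) (ι : S →ₙ* G), Function.Injective ι ∧
      ∀ g, ∃ a b, g = ι b / ι a := by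
  let G := Algebra.GrothendieckGroup (WithOne S)
  let ι : S →ₙ* G :=
    { toFun := fun s => Algebra.GrothendieckGroup.of (s : WithOne S)
      map_mul' := fun x y => by rw [WithOne.coe_mul, map_mul] }
  refine ⟨G, inferInstance, ι, fun x y h => ?_, fun g => ?_⟩
  · obtain ⟨⟨c, _⟩, hc⟩ := (Localization.monoidOf (⊤ : Submonoid (WithOne S))).eq_iff_exists.1 h
    induction c with
    | one => exact WithOne.coe_injective (by simpa using hc)
    | coe c =>
      change (c : WithOne S) * x = c * y at hc
      rw [← WithOne.coe_mul, ← WithOne.coe_mul] at hc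
      exact mul_left_cancel (WithOne.coe_injective hc)
  · obtain ⟨⟨x, ⟨y, _⟩⟩, h⟩ := (Localization.monoidOf (⊤ : Submonoid (WithOne S))).surj g
    obtain ⟨s⟩ := ‹Nonempty S›
    have key : ∀ x : WithOne S, ∃ t : S, x * s = t := by
      intro x
      induction x with
      | one => exact ⟨s, one_mul _⟩
      | coe x => exact ⟨x * s, rfl⟩
    obtain ⟨a, ha⟩ := key y
    obtain ⟨b, hb⟩ := key x
    refine ⟨a, b, eq_div_of_mul_eq' ?_⟩
    change g * Algebra.GrothendieckGroup.of (a : WithOne S) =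
      Algebra.GrothendieckGroup.of (b : WithOne S)
    rw [← ha, ← hb, map_mul, map_mul, ← mul_assoc]
    exact congrArg (· * _) h

variable {S : Type*} [CommSemigroup S] [IsCancelMul S]

/-- The quotients `ι b / ι a` with `a ≤ b` are the positive cone of a linear order on the group of
fractions. The closure of `{(a, b)}` consists of the pairs `(a ^ k, b ^ k)` with `k ≥ 1`, so `harch`
is the Archimedean property. -/
theorem exists_injective_monotone_real [Nonempty S] [PartialOrder S] [MulLeftMono S]
    (htotal : ∀ a b : S, a ≤ b ∨ b ≤ a)
    (harch : ∀ a b x y : S, a < b →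
      ∃ p ∈ Subsemigroup.closure {((a, b) : S × S)}, x * p.1 ≤ y * p.2) :
    ∃ φ : S → ℝ, Function.Injective φ ∧ Monotone φ ∧ ∀ x y, φ (x * y) = φ x + φ y := by
  classical
  obtain ⟨G, _, ι, hι, hsurj⟩ := exists_injective_mulHom_commGroup (S := S)
  have hle : ∀ {c x y : S}, c * x ≤ c * y → x ≤ y := by
    intro c x y h
    rcases htotal x y with h' | h'
    · exact h'
    · exact (mul_left_cancel (le_antisymm h (mul_le_mul_right h' c))).le
  have hwd : ∀ {a b c d : S}, ι b / ι a = ι d / ι c → a ≤ b → c ≤ d := by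
    intro a b c d h hab
    rw [div_eq_div_iff_mul_eq_mul, ← map_mul, ← map_mul] at h
    have h := hι h
    refine hle (c := a) ?_
    rw [mul_comm a d, ← h]
    exact mul_le_mul_left hab c
  let C : GroupCone G :=
    { carrier := {g | ∃ a b, a ≤ b ∧ g = ι b / ι a}
      one_mem' := ⟨Classical.arbitrary S, Classical.arbitrary S, le_rfl, by simp⟩
      mul_mem' := by
        rintro _ _ ⟨a, b, hab, rfl⟩ ⟨c, d, hcd, rfl⟩
        exact ⟨a * c, b * d, mul_le_mul' hab hcd, by rw [map_mul, map_mul, div_mul_div_comm]⟩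
      eq_one_of_mem_of_inv_mem' := by
        rintro _ ⟨a, b, hab, rfl⟩ ⟨c, d, hcd, h⟩
        rw [inv_div] at h
        rw [le_antisymm hab (hwd h.symm hcd), div_self'] }
  have hC : ∀ {a b}, ι b / ι a ∈ C ↔ a ≤ b :=
    ⟨fun ⟨c, d, hcd, h⟩ => hwd h.symm hcd, fun h => ⟨_, _, h, rfl⟩⟩
  have : HasMemOrInvMem C := ⟨fun g => by
    obtain ⟨a, b, rfl⟩ := hsurj g
    rw [inv_div, hC, hC]
    exact htotal a b⟩
  let _ : LinearOrder G := LinearOrder.mkOfGroupCone C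
  have : IsOrderedMonoid G := IsOrderedMonoid.mkOfCone C
  have hιle : ∀ {a b}, ι a ≤ ι b ↔ a ≤ b := hC
  have : MulArchimedean G := ⟨fun g h hh => by
    obtain ⟨x, y, rfl⟩ := hsurj g
    obtain ⟨a, b, rfl⟩ := hsurj h
    rw [one_lt_div', ← not_le, hιle] at hh
    have hab : a < b := lt_of_le_of_ne ((htotal a b).resolve_right hh) (by rintro rfl; simp at hh)
    obtain ⟨p, hp, hle⟩ := harch a b y x hab
    have hpow : ∃ n : ℕ, ι p.2 / ι p.1 = (ι b / ι a) ^ n := by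
      clear hle
      induction hp using Subsemigroup.closure_induction with
      | mem q hq => rw [Set.mem_singleton_iff.1 hq]; exact ⟨1, (pow_one _).symm⟩
      | mul q r _ _ hq hr =>
        obtain ⟨m, hm⟩ := hq
        obtain ⟨n, hn⟩ := hr
        exact ⟨m + n, by rw [pow_add, ← hm, ← hn, Prod.fst_mul, Prod.snd_mul, map_mul, map_mul,
          div_mul_div_comm]⟩
    obtain ⟨n, hn⟩ := hpow
    refine ⟨n, ?_⟩
    rw [← hn, div_le_div_iff', ← map_mul, ← map_mul, hιle, mul_comm p.2]
    exact hle⟩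
  obtain ⟨f, hf⟩ := Archimedean.exists_orderAddMonoidHom_real_injective (Additive G)
  refine ⟨fun s => f (Additive.ofMul (ι s)), fun x y h => ?_, fun x y h => ?_, fun x y => ?_⟩
  · exact hι (Additive.ofMul.injective (hf h))
  · exact f.monotone' (hιle.2 h)
  · simp only [map_mul, ofMul_mul, map_add]

end RealEmbedding

/-! ### Classification of the simple semirings -/

section Classification

variable {S : Type*} [AddCommSemigroup S] [CommSemigroup S]

/-- If all values have one weak sign, the elements at least as far out as `t * t` form an ideal. It
contains `t * t` and `t * t * t` but not `t`. -/
theorem CongruenceSimple.exists_pos_and_exists_neg (hS : CongruenceSimple S) {φ : S → ℝ}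
    (hinj : Function.Injective φ) (hadd : ∀ x y, φ (x + y) = max (φ x) (φ y))
    (hmul : ∀ x y, φ (x * y) = φ x + φ y) : (∃ p, 0 < φ p) ∧ ∃ q, φ q < 0 := by
  obtain ⟨t, ht⟩ : ∃ t, φ t ≠ 0 := by
    obtain ⟨a, b, hab⟩ := (congruenceSimple_iff.1 hS).1
    by_contra! h
    exact hab (hinj (by rw [h, h]))
  constructor
  · by_contra! h
    have ht' := lt_of_le_of_ne (h t) ht
    have := hS.mem_of_ideal (I := {x | φ x ≤ φ (t * t)})
      (fun x hx z => by
        rw [Set.mem_ofPred_eq] at hx ⊢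
        rw [hmul]
        linarith [h z])
      (fun x hx z => by
        rw [Set.mem_ofPred_eq] at hx ⊢
        rw [hmul z]
        linarith [h z])
      (fun x hx y hy z => by
        simp only [Set.mem_ofPred_eq] at hx hy ⊢
        rcases le_total (φ z) (φ (t * t)) with hz | hz
        · exact Or.inr ⟨by rw [hadd]; exact max_le hx hz, by rw [hadd]; exact max_le hy hz⟩
        · exact Or.inl (hinj (by rw [hadd, hadd, max_eq_right (hx.trans hz),
            max_eq_right (hy.trans hz)])))
      ⟨t * t, le_refl (φ (t * t)), t * t * t, by
          rw [Set.mem_ofPred_eq, hmul (t * t)]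
          linarith, fun he => by
          have := congrArg φ he
          rw [hmul (t * t)] at this
          linarith⟩ t
    rw [Set.mem_ofPred_eq, hmul] at this
    linarith
  · by_contra! h
    have ht' := lt_of_le_of_ne (h t) ht.symm
    have := hS.mem_of_ideal (I := {x | φ (t * t) ≤ φ x})
      (fun x hx z => by
        rw [Set.mem_ofPred_eq] at hx ⊢
        rw [hmul x]
        linarith [h z])
      (fun x hx z => by
        rw [Set.mem_ofPred_eq] at hx ⊢
        rw [hmul z]
        linarith [h z])
      (fun x hx y hy z => by
        simp only [Set.mem_ofPred_eq] at hx hy ⊢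
        exact Or.inr ⟨by rw [hadd]; exact le_max_of_le_left hx,
          by rw [hadd]; exact le_max_of_le_left hy⟩)
      ⟨t * t, le_refl (φ (t * t)), t * t * t, by
          rw [Set.mem_ofPred_eq, hmul (t * t)]
          linarith, fun he => by
          have := congrArg φ he
          rw [hmul (t * t)] at this
          linarith⟩ t
    rw [Set.mem_ofPred_eq, hmul] at this
    linarith

variable [LeftDistribClass S] [RightDistribClass S]

theorem CongruenceSimple.exists_maxPlus [IsCancelMul S] (hidem : ∀ a : S, a + a = a)
    (hS : CongruenceSimple S) :
    ∃ φ : S → ℝ, Function.Injective φ ∧ (∀ x y, φ (x + y) = max (φ x) (φ y)) ∧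
      ∀ x y, φ (x * y) = φ x + φ y := by
  let _ : PartialOrder S :=
    { le := fun a b => a + b = b
      le_refl := hidem
      le_trans := fun a b c (hab : a + b = b) (hbc : b + c = c) => by
        rw [← hbc, ← add_assoc, hab]
      le_antisymm := fun a b (hab : a + b = b) (hba : b + a = a) => by
        rw [← hab, add_comm, hba] }
  have hle : ∀ {a b : S}, a ≤ b ↔ a + b = b := Iff.rfl
  have : MulLeftMono S := ⟨fun c a b h => by
    rw [hle, ← mul_add, hle.1 h]⟩
  have hadd_mono : ∀ {a b c d : S}, a ≤ b → c ≤ d → a + c ≤ b + d := by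
    intro a b c d h h'
    rw [hle, add_add_add_comm, hle.1 h, hle.1 h']
  have hcancel : ∀ {a b c : S}, c * a ≤ c * b → a ≤ b := by
    intro a b c h
    rw [hle, ← mul_add] at h
    exact mul_left_cancel h
  have hK : ∀ {a b : S}, a ≤ b → ∀ p ∈ Subsemigroup.closure {((a, b) : S × S)}, p.1 ≤ p.2 := by
    intro a b hab p hp
    induction hp using Subsemigroup.closure_induction with
    | mem q hq => rw [Set.mem_singleton_iff.1 hq]; exact hab
    | mul q r _ _ hq hr => exact mul_le_mul' hq hr
  have harch : ∀ a b x y : S, a < b →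
      ∃ p ∈ Subsemigroup.closure {((a, b) : S × S)}, x * p.1 ≤ y * p.2 := by
    intro a b x y hab
    have hmem : (a, b) ∈ Subsemigroup.closure {((a, b) : S × S)} :=
      Subsemigroup.subset_closure rfl
    -- A preorder compatible with both operations; its symmetric part is a congruence identifying
    -- `a` and `b`, hence full.
    let q : S → S → Prop := fun x y =>
      ∃ p ∈ Subsemigroup.closure {((a, b) : S × S)}, x * p.1 ≤ y * p.2
    have hrefl : ∀ x, q x x := fun x => ⟨_, hmem, mul_le_mul' le_rfl hab.le⟩
    have htrans : ∀ {x y z}, q x y → q y z → q x z := by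
      rintro x y z ⟨p, hp, h⟩ ⟨p', hp', h'⟩
      refine ⟨p * p', mul_mem hp hp', ?_⟩
      calc x * (p.1 * p'.1) = x * p.1 * p'.1 := (mul_assoc _ _ _).symm
        _ ≤ y * p.2 * p'.1 := mul_le_mul' h le_rfl
        _ = y * p'.1 * p.2 := mul_right_comm _ _ _
        _ ≤ z * p'.2 * p.2 := mul_le_mul' h' le_rfl
        _ = z * (p.2 * p'.2) := by rw [mul_assoc, mul_comm p'.2]
    have hadd : ∀ {x y x' y'}, q x y → q x' y' → q (x + x') (y + y') := by
      rintro x y x' y' ⟨p, hp, h⟩ ⟨p', hp', h'⟩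
      refine ⟨p * p', mul_mem hp hp', ?_⟩
      rw [Prod.fst_mul, Prod.snd_mul, add_mul, add_mul, ← mul_assoc x, ← mul_assoc y,
        mul_comm p.1, mul_comm p.2, ← mul_assoc x', ← mul_assoc y']
      exact hadd_mono (mul_le_mul' h (hK hab.le p' hp')) (mul_le_mul' h' (hK hab.le p hp))
    have hmul : ∀ {x y x' y'}, q x y → q x' y' → q (x * x') (y * y') := by
      rintro x y x' y' ⟨p, hp, h⟩ ⟨p', hp', h'⟩
      refine ⟨p * p', mul_mem hp hp', ?_⟩
      rw [Prod.fst_mul, Prod.snd_mul, mul_mul_mul_comm, mul_mul_mul_comm y]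
      exact mul_le_mul' h h'
    let c : RingCon S :=
      { r := fun x y => q x y ∧ q y x
        iseqv := ⟨fun x => ⟨hrefl x, hrefl x⟩, And.symm,
          fun h h' => ⟨htrans h.1 h'.1, htrans h'.2 h.2⟩⟩
        add' := fun h h' => ⟨hadd h.1 h'.1, hadd h.2 h'.2⟩
        mul' := fun h h' => ⟨hmul h.1 h'.1, hmul h.2 h'.2⟩ }
    have hab' : c a b :=
      ⟨⟨_, hmem, mul_le_mul' hab.le hab.le⟩, ⟨_, hmem, (mul_comm b a).le⟩⟩
    exact ((congruenceSimple_iff.1 hS).2 c a b hab.ne hab' x y).1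
  have htotal : ∀ a b : S, a ≤ b ∨ b ≤ a := by
    intro a b
    obtain ⟨c, hc⟩ : ∃ c, c = a + b := ⟨_, rfl⟩
    have hac : a ≤ c := by rw [hle, hc, ← add_assoc, hidem]
    have hbc : b ≤ c := by rw [hle, hc, add_left_comm, hidem]
    rcases hbc.eq_or_lt with rfl | hbc'
    · exact Or.inl hac
    right
    obtain ⟨p, hp, h⟩ := harch b c c a hbc'
    -- Factors `b` on the left and `c` on the right are stripped one pair at a time: expand `c * (c
    -- * s)` by `c = a + b`, bound both terms by `c * (a * t)`, cancel `c`.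
    have key : ∀ s t, s ≤ t → c * (p.1 * s) ≤ a * (p.2 * t) → c * s ≤ a * t := by
      clear h
      induction hp using Subsemigroup.closure_induction with
      | mem q hq =>
        rw [Set.mem_singleton_iff.1 hq]
        intro s t hst h
        refine hcancel (c := c) ?_
        have h₁ : a * (c * s) ≤ c * (a * t) := by
          rw [mul_left_comm c a]
          exact mul_le_mul' le_rfl (mul_le_mul' le_rfl hst)
        have h₂ : b * (c * s) ≤ c * (a * t) := by
          rw [mul_left_comm b c, mul_left_comm c a]
          exact h
        calc c * (c * s) = a * (c * s) + b * (c * s) := by rw [← add_mul, ← hc]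
          _ ≤ c * (a * t) + c * (a * t) := hadd_mono h₁ h₂
          _ = c * (a * t) := hidem _
      | mul q r hq hr ihq ihr =>
        intro s t hst h
        rw [Prod.fst_mul, Prod.snd_mul, mul_assoc, mul_assoc] at h
        exact ihr s t hst (ihq _ _ (mul_le_mul' (hK hbc r hr) hst) h)
    have hca : a * c ≤ a * a := by
      rw [mul_comm a c]
      refine key a a le_rfl ?_
      rw [← mul_assoc, ← mul_assoc]
      exact mul_le_mul' h le_rfl
    exact hbc.trans (hcancel hca)
  have : Nonempty S := (congruenceSimple_iff.1 hS).1.to_nonempty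
  obtain ⟨φ, hinj, hmono, hmul⟩ := exists_injective_monotone_real htotal harch
  refine ⟨φ, hinj, fun x y => ?_, hmul⟩
  rcases htotal x y with h | h
  · rw [hle.1 h, max_eq_right (hmono h)]
  · rw [add_comm, hle.1 h, max_eq_left (hmono h)]

theorem CongruenceSimple.isCancelMul_or_twoLattice (hidem : ∀ a : S, a + a = a)
    (hS : CongruenceSimple S) (hSS : (Set.univ * Set.univ : Set S).encard ≠ 1)
    (hw : ¬ ∃ w : S, IsBiAbsorbing w) : IsCancelMul S ∨ Nonempty (S ≃+* TwoLattice) := by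
  obtain ⟨hnt, hS⟩ := congruenceSimple_iff.1 hS
  have hfaith : ∀ x y : S, (∀ z, x * z = y * z) → x = y := by
    intro x y hxy
    by_contra hne
    let c : RingCon S :=
      { r := fun x y => ∀ z, x * z = y * z
        iseqv := ⟨fun _ _ => rfl, fun h z => (h z).symm, fun h h' z => (h z).trans (h' z)⟩
        add' := fun h h' z => by rw [add_mul, add_mul, h, h']
        mul' := fun h h' z => by rw [mul_assoc, h, h', mul_left_comm, mul_assoc, mul_left_comm] }
    have hc : ∀ x y z : S, x * z = y * z := hS c x y hne hxy
    apply hSS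
    rw [Set.encard_eq_one]
    refine ⟨x * x, Set.eq_singleton_iff_unique_mem.2
      ⟨Set.mul_mem_mul trivial trivial, ?_⟩⟩
    rintro _ ⟨a, -, b, -, rfl⟩
    change a * b = x * x
    rw [hc a x b, mul_comm, hc b x x]
  have hcan : ∀ a : S, (∀ x y, a * x = a * y) ∨ ∀ x y, a * x = a * y → x = y := by
    intro a
    by_contra! h
    obtain ⟨⟨u, v, huv⟩, x, y, hxy, hne⟩ := h
    let c : RingCon S :=
      { r := fun x y => a * x = a * y
        iseqv := ⟨fun _ => rfl, fun h => h.symm, fun h h' => h.trans h'⟩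
        add' := fun {x y z w} (h : a * x = a * y) (h' : a * z = a * w) => by
          rw [mul_add, mul_add, h, h']
        mul' := fun {x y z w} (h : a * x = a * y) (h' : a * z = a * w) => by
          rw [← mul_assoc, h, mul_assoc, mul_left_comm, h', mul_left_comm] }
    exact huv (hS c x y hne hxy u v)
  by_cases ho : ∃ o : S, ∀ x y, o * x = o * y
  · right
    obtain ⟨o, ho⟩ := ho
    have hmul : ∀ x, o * x = o := fun x => hfaith _ _ fun z => by rw [mul_assoc]; exact ho _ _
    have hmul' : ∀ x, x * o = o := fun x => by rw [mul_comm, hmul]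
    have hdom : ∀ x y : S, x * y = o ↔ x = o ∨ y = o := by
      intro x y
      refine ⟨fun h => ?_, ?_⟩
      · rcases hcan x with hx | hx
        · left
          exact hfaith _ _ fun z => by rw [hx z o, hmul', hmul]
        · exact Or.inr (hx _ _ (by rw [h, hmul']))
      · rintro (rfl | rfl)
        · exact hmul y
        · exact hmul' x
    -- The relation `x + o = y + o` identifies `x + o` with `x`; if it were full, `o` would be
    -- bi-absorbing.
    have hzero : ∀ x : S, x + o = x := by
      let c : RingCon S :=
        { r := fun x y => x + o = y + o
          iseqv := ⟨fun _ => rfl, fun h => h.symm, fun h h' => h.trans h'⟩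
          add' := fun {x y z w} (h : x + o = y + o) (h' : z + o = w + o) => by
            rw [← hidem o, add_add_add_comm, h, h', add_add_add_comm]
          mul' := fun {x y z w} (h : x + o = y + o) (h' : z + o = w + o) => by
            have key : ∀ u v : S, u * v + o = (u + o) * (v + o) := fun u v => by
              rw [add_mul, mul_add, hmul, hmul', add_assoc, hidem]
            change x * z + o = y * w + o
            rw [key, key, h, h'] }
      intro x
      by_contra hx
      have hc : ∀ x y : S, x + o = y + o := hS c (x + o) x hx (by
        change x + o + o = x + o
        rw [add_assoc, hidem])
      exact hw ⟨o, hmul', hmul, fun a => by rw [hc a o, hidem]⟩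
    have hadd : ∀ x y : S, x + y = o ↔ x = o ∧ y = o := by
      intro x y
      refine ⟨fun h => ?_, ?_⟩
      · have : ∀ u v : S, u + v = o → u = o := fun u v h => by
          rw [← hzero u, ← h, ← add_assoc, hidem]
        exact ⟨this x y h, this y x (by rw [add_comm, h])⟩
      · rintro ⟨rfl, rfl⟩
        exact hidem _
    -- This has the classes `{o}` and its complement and is not full, so the complement is a single
    -- element.
    let c : RingCon S :=
      { r := fun x y => x = o ↔ y = o
        iseqv := ⟨fun _ => Iff.rfl, fun h => h.symm, fun h h' => h.trans h'⟩
        add' := fun h h' => by rw [hadd, hadd, h, h']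
        mul' := fun h h' => by rw [hdom, hdom, h, h'] }
    obtain ⟨e, he⟩ := exists_ne o
    have hne : ∀ x y : S, x ≠ o → y ≠ o → x = y := by
      intro x y hx hy
      by_contra hxy
      exact he ((hS c x y hxy (iff_of_false hx hy) o e).1 rfl)
    exact nonempty_ringEquiv_twoLattice he.symm (fun x => or_iff_not_imp_left.2 fun hx =>
      hne x e hx he) (hidem e) hzero hmul (hne _ _ (fun h => by simp [hdom, he] at h) he)
  · left
    push Not at ho
    have hcan' : ∀ a x y : S, a * x = a * y → x = y := fun a => (hcan a).resolve_left fun h => by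
      obtain ⟨x, y, hxy⟩ := ho a
      exact hxy (h x y)
    exact { mul_left_cancel := fun a x y h => hcan' a x y h
            mul_right_cancel := fun a x y h => hcan' a x y (by
              change x * a = y * a at h
              rw [mul_comm a, h, mul_comm]) }

end Classification

/-! ### Realisation as a subsemiring of max-plus -/

section Range

variable {S : Type*} [AddCommSemigroup S] [CommSemigroup S]

theorem MaxPlus.toReal_injective : Function.Injective MaxPlus.toReal := fun _ _ h =>
  Tropical.untrop_injective (OrderDual.ofDual.injective h)

/-- The image of a max-plus valued homomorphism. -/
def MaxPlus.range {φ : S → ℝ} (hadd : ∀ x y, φ (x + y) = max (φ x) (φ y))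
    (hmul : ∀ x y, φ (x * y) = φ x + φ y) (h : Nonempty S) : PlainSubsemiring MaxPlus where
  carrier := {x | ∃ s, φ s = toReal x}
  add_mem' := by
    rintro x y ⟨s, hs⟩ ⟨t, ht⟩
    exact ⟨s + t, by rw [hadd, toReal_add, hs, ht]⟩
  mul_mem' := by
    rintro x y ⟨s, hs⟩ ⟨t, ht⟩
    exact ⟨s * t, by rw [hmul, toReal_mul, hs, ht]⟩
  nonempty' := h.elim fun s => ⟨Tropical.trop (OrderDual.toDual (φ s)), s, rfl⟩

theorem MaxPlus.nonempty_ringEquiv_range {φ : S → ℝ} (hinj : Function.Injective φ)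
    (hadd : ∀ x y, φ (x + y) = max (φ x) (φ y)) (hmul : ∀ x y, φ (x * y) = φ x + φ y)
    (h : Nonempty S) : Nonempty (S ≃+* MaxPlus.range hadd hmul h) := by
  let f : S → MaxPlus.range hadd hmul h := fun s =>
    ⟨Tropical.trop (OrderDual.toDual (φ s)), s, rfl⟩
  have hf : Function.Bijective f :=
    ⟨fun x y hxy => hinj (congrArg (fun z : MaxPlus.range hadd hmul h => toReal z.1) hxy),
      fun ⟨x, s, hs⟩ => ⟨s, Subtype.ext (toReal_injective hs)⟩⟩
  exact ⟨{ Equiv.ofBijective f hf with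
    map_mul' := fun x y => Subtype.ext (toReal_injective (hmul x y))
    map_add' := fun x y => Subtype.ext (toReal_injective (hadd x y)) }⟩

end Range

theorem mainTheorem4 {S : Type*} [Nonempty S] [AddCommSemigroup S] [CommSemigroup S]
    [LeftDistribClass S] [RightDistribClass S] (hidem : ∀ a : S, a + a = a)
    (n : ℕ) [NeZero n] (hn : 2 ≤ n) :
    List.TFAE [
      CongruenceSimple (MatrixSemiring n S),
      CongruenceSimple S ∧ (Set.univ * Set.univ : Set S).encard ≠ 1 ∧
        ¬ ∃ w : S, IsBiAbsorbing w,
      Nonempty (S ≃+* TwoLattice) ∨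
        ∃ A : PlainSubsemiring MaxPlus,
          (∃ x ∈ A, 0 < MaxPlus.toReal x) ∧ (∃ x ∈ A, MaxPlus.toReal x < 0) ∧
          Nonempty (S ≃+* A)] := by
  tfae_have 1 → 2 := fun h => ⟨h.of_matrixSemiring, encard_mul_ne_one_of_matrixSemiring h hn,
    fun ⟨w, hw⟩ => not_isBiAbsorbing_of_matrixSemiring h hn w hw⟩
  tfae_have 2 → 3 := by
    rintro ⟨hS, hSS, hw⟩
    rcases hS.isCancelMul_or_twoLattice hidem hSS hw with _ | h
    · right
      obtain ⟨φ, hinj, hadd, hmul⟩ := hS.exists_maxPlus hidem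
      obtain ⟨⟨p, hp⟩, q, hq⟩ := hS.exists_pos_and_exists_neg hinj hadd hmul
      exact ⟨MaxPlus.range hadd hmul inferInstance,
        ⟨Tropical.trop (OrderDual.toDual (φ p)), ⟨p, rfl⟩, hp⟩,
        ⟨Tropical.trop (OrderDual.toDual (φ q)), ⟨q, rfl⟩, hq⟩,
        MaxPlus.nonempty_ringEquiv_range hinj hadd hmul inferInstance⟩
    · exact Or.inl h
  tfae_have 3 → 1 := by
    rintro (⟨⟨e⟩⟩ | ⟨A, ⟨x, hx, hx'⟩, ⟨y, hy, hy'⟩, ⟨e⟩⟩)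
    · exact congruenceSimple_matrixSemiring_of_twoLattice hidem e n
    · refine congruenceSimple_matrixSemiring_of_maxPlus (φ := fun s => MaxPlus.toReal (e s))
        (fun s t h => e.injective (Subtype.ext (MaxPlus.toReal_injective h)))
        (fun s t => ?_) (fun s t => ?_) (p := e.symm ⟨x, hx⟩) (q := e.symm ⟨y, hy⟩) ?_ ?_ n
      · simp only [map_add]
        rfl
      · simp only [map_mul]
        rfl
      · simpa using hx'
      · simpa using hy'
  tfae_finish
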